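/- A \emph{stochastic game with rewards} consists of a finite set $V$ of vertices partitioned into $V_1, V_2, V_{\mathsf P}$, a map $\delta : V\times V\to[0,1]$ with $\delta(v,v')\in\{0,1\}$ for $v\in V_1\cup V_2$ and $\sum_{v'}\delta(v,v')=1$ for $v\in V_{\mathsf P}$, such that $\mathrm{post}(v)=\{v' : \delta(v,v')>0\}$ is non-empty for every $v$, and a reward function $r:V\to[0,\infty)$ that vanishes on the set $T$ of terminal vertices, i.e. of the $v$ with $\delta(v,v)=1$ and $\delta(v,v')=0$ for all $v'\ne v$. A path is a sequence $\omega\in V^{\mathbb N}$ with $\delta(\omega_k,\omega_{k+1})>0$ for all $k$. A strategy of Player $i\in\{1,2\}$ assigns to every finite sequence of vertices that ends in a vertex $v \in V_i$ a probability distribution on $V$ supported in $\mathrm{post}(v)$; it may be randomized and history-dependent. It is deterministic if all these distributions are Dirac, and memoryless if they depend on $v$ only. Let $\Pi_i$ be the set of strategies of Player $i$. Strategies $\pi_1\in\Pi_1,\pi_2\in\Pi_2$ and an initial vertex $v$ induce a probability measure $\mathbb P^{\pi_1,\pi_2}_v$ on $V^{\mathbb N}$, where the next vertex is drawn according to $\pi_1$,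 $\pi_2$ or $\delta$ as the current vertex is in $V_1$, $V_2$ or $V_{\mathsf P}$; let $\mathbb E^{\pi_1,\pi_2}_v$ be the expectation. A strategy $\pi_2\in\Pi_2$ is \emph{fair} if, for all $\pi_1\in\Pi_1$ and $v\in V$, $\mathbb P^{\pi_1,\pi_2}_v$-almost every $\omega$ is a path with the property that whenever some $v'\in V_2$ occurs infinitely often in $\omega$, so does every element of $\mathrm{post}(v')$. Let $\Pi_2^{F}$ be the set of fair strategies. The game is \emph{stopping under fairness} if $\mathbb P^{\pi_1,\pi_2}_v(\exists n:\omega_n\in T)=1$ for all $\pi_1\in\Pi_1$, $\pi_2\in\Pi_2^{F}$, $v\in V$. Let $\mathrm{rew}(\omega)=\sum_{n\ge0}r(\omega_n)\in[0,\infty]$. Let $\Pi_1^{DM}\subseteq\Pi_1$ and $\Pi_2^{DMF}\subseteq\Pi_2^{F}$ be the subsets of deterministic memoryless strategies, let $$\mathbf U=\max_{v\in V}\ \inf_{\pi_2\in\Pi_2^{DMF}}\ \sup_{\pi_1\in\Pi_1^{DM}}\mathbb E^{\pi_1,\pi_2}_v[\mathrm{rew}],$$ and for $f:V\to[0,\infty]$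 let $$\Gamma(f)(v)=\begin{cases}0 & v\in T,\\ r(v)+\sum_{v'\in\mathrm{post}(v)}\delta(v,v')f(v') & v\in V_{\mathsf P}\setminus T,\\ \max\{r(v)+f(v') : v'\in\mathrm{post}(v)\} & v\in V_1\setminus T,\\ \min\{r(v)+f(v') : v'\in\mathrm{post}(v)\} & v\in V_2\setminus T.\end{cases}$$ \textbf{Theorem.} Let a stochastic game with rewards be stopping under fairness. Then $\mathbf U<\infty$, the set of all $f\in[0,\mathbf U]^V$ with $\Gamma(f)=f$ has a greatest element $\nu\Gamma$ for the pointwise order, and for every $v\in V$ $$\inf_{\pi_2\in\Pi_2^{F}}\ \sup_{\pi_1\in\Pi_1}\mathbb E^{\pi_1,\pi_2}_v[\mathrm{rew}]=\sup_{\pi_1\in\Pi_1}\ \inf_{\pi_2\in\Pi_2^{F}}\mathbb E^{\pi_1,\pi_2}_v[\mathrm{rew}]=\nu\Gamma(v).$$ -/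

import Mathlib

open MeasureTheory ProbabilityTheory
open scoped ENNReal NNReal

/-- Who controls a vertex: Player 1, Player 2, or chance. -/
inductive VertexKind where
  | player1
  | player2
  | random

/-- A stochastic game on a finite vertex set `V`, partitioned into the vertices of Player 1,
of Player 2 and the probabilistic ones by `kind`. The axioms imply `δ v v' ≤ 1`. -/
structure StochasticGame (V : Type*) [Fintype V] where
  kind : V → VertexKind
  δ : V → V → ℝ≥0
  δ_player1 : ∀ v, kind v = VertexKind.player1 → ∀ v', δ v v' = 0 ∨ δ v v' = 1
  δ_player2 : ∀ v, kind v = VertexKind.player2 → ∀ v', δ v v' = 0 ∨ δ v v' = 1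
  δ_random : ∀ v, kind v = VertexKind.random → ∑ v', δ v v' = 1
  exists_succ : ∀ v, ∃ v', 0 < δ v v'

namespace StochasticGame

variable {V : Type*} [Fintype V] (G : StochasticGame V)

/-- The set of successors of a vertex. -/
def post (v : V) : Set V := {v' | 0 < G.δ v v'}

/-- The set of terminal vertices. -/
def terminal : Set V := {v | G.δ v v = 1 ∧ ∀ v', v' ≠ v → G.δ v v' = 0}

/-- Infinite paths of the game. -/
def paths : Set (ℕ → V) := {ω | ∀ k, 0 < G.δ (ω k) (ω (k + 1))}

/-- Strategies of the player controlling the vertices of kind `i`: to every finite sequence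
`h` of vertices followed by a vertex `v` of kind `i` they assign a probability distribution on
the vertices that is supported in `post v`. -/
structure Strategy (i : VertexKind) where
  move : List V → {v : V // G.kind v = i} → PMF V
  support_subset : ∀ h v, (move h v).support ⊆ G.post v

variable {G} in
/-- Pure strategies: all choices are Dirac distributions. -/
def Strategy.Deterministic {i : VertexKind} (σ : G.Strategy i) : Prop :=
  ∀ h v, ∃ v', σ.move h v = PMF.pure v'

variable {G} in
/-- Strategies whose choices depend on the current vertex only. -/
def Strategy.Memoryless {i : VertexKind} (σ : G.Strategy i) : Prop :=
  ∀ h v, σ.move h v = σ.move [] v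

abbrev Strategy1 := G.Strategy VertexKind.player1

abbrev Strategy2 := G.Strategy VertexKind.player2

/-- The distribution of the next vertex at a probabilistic vertex. -/
noncomputable def randomStep (v : V) (hv : G.kind v = VertexKind.random) : PMF V :=
  PMF.ofFintype (fun v' => (G.δ v v' : ℝ≥0∞)) (by
    rw [← ENNReal.ofNNReal_finsetSum, G.δ_random v hv, ENNReal.coe_one])

variable {G} in
/-- The distribution of the next vertex after the history `h` followed by the current
vertex `v`. -/
noncomputable def step (σ₁ : G.Strategy1) (σ₂ : G.Strategy2) (h : List V) (v : V) : PMF V :=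
  match hv : G.kind v with
  | VertexKind.player1 => σ₁.move h ⟨v, hv⟩
  | VertexKind.player2 => σ₂.move h ⟨v, hv⟩
  | VertexKind.random => G.randomStep v hv

variable [MeasurableSpace V] [DiscreteMeasurableSpace V]

variable {G} in
/-- The transition kernel from the first `n + 1` vertices of a play to the next vertex. -/
noncomputable def stepKernel (σ₁ : G.Strategy1) (σ₂ : G.Strategy2) (n : ℕ) :
    Kernel ((_ : Finset.Iic n) → V) V where
  toFun x := (step σ₁ σ₂
    (List.ofFn fun k : Fin n => x ⟨k, Finset.mem_Iic.2 k.isLt.le⟩)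
    (x ⟨n, Finset.mem_Iic.2 le_rfl⟩)).toMeasure
  measurable' := Measurable.of_discrete

instance isMarkovKernel_stepKernel (σ₁ : G.Strategy1) (σ₂ : G.Strategy2) (n : ℕ) :
    IsMarkovKernel (stepKernel σ₁ σ₂ n) :=
  ⟨fun _ => PMF.toMeasure.isProbabilityMeasure _⟩

variable {G} in
/-- The law on `V^∞` of the play that starts in `v` when the players use `σ₁` and `σ₂`. -/
noncomputable def prob (σ₁ : G.Strategy1) (σ₂ : G.Strategy2) (v : V) : Measure (ℕ → V) :=
  Kernel.traj (X := fun _ => V) (stepKernel σ₁ σ₂) 0 (fun _ => v)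

/-- Plays fair for Player 2: if a Player 2 vertex is visited infinitely often, then so are all
its successors. -/
def fairPaths : Set (ℕ → V) :=
  {ω | ω ∈ G.paths ∧ ∀ v, G.kind v = VertexKind.player2 →
    (∃ᶠ n in Filter.atTop, ω n = v) → ∀ v' ∈ G.post v, ∃ᶠ n in Filter.atTop, ω n = v'}

/-- Plays that reach a terminal vertex. -/
def reachTerminal : Set (ℕ → V) := {ω | ω ∈ G.paths ∧ ∃ n, ω n ∈ G.terminal}

/-- The (almost-sure) fair strategies of Player 2. -/
def fairStrategies : Set G.Strategy2 :=
  {σ₂ | ∀ (σ₁ : G.Strategy1) (v : V), prob σ₁ σ₂ v G.fairPaths = 1}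

/-- The game almost surely reaches a terminal vertex whenever Player 2 plays fairly. -/
def StoppingUnderFairness : Prop :=
  ∀ (σ₁ : G.Strategy1), ∀ σ₂ ∈ G.fairStrategies, ∀ v : V, prob σ₁ σ₂ v G.reachTerminal = 1

/-- The deterministic memoryless strategies of Player 1. -/
def detMemoryless1 : Set G.Strategy1 := {σ₁ | σ₁.Deterministic ∧ σ₁.Memoryless}

/-- The deterministic memoryless fair strategies of Player 2. -/
def detMemorylessFair2 : Set G.Strategy2 :=
  {σ₂ | σ₂.Deterministic ∧ σ₂.Memoryless ∧ σ₂ ∈ G.fairStrategies}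

end StochasticGame

/-- A stochastic game with non-negative rewards that vanish at the terminal vertices. -/
structure RewardGame (V : Type*) [Fintype V] extends StochasticGame V where
  r : V → ℝ≥0
  r_terminal : ∀ v ∈ toStochasticGame.terminal, r v = 0

namespace RewardGame

variable {V : Type*} [Fintype V] (G : RewardGame V)

/-- The total accumulated reward of a play. -/
noncomputable def rew (ω : ℕ → V) : ℝ≥0∞ := ∑' n, (G.r (ω n) : ℝ≥0∞)

open Classical in
/-- The Bellman functional. The suprema and infima range over finite non-empty sets. -/
noncomputable def bellman (f : V → ℝ≥0∞) (v : V) : ℝ≥0∞ :=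
  if v ∈ G.terminal then 0
  else match G.kind v with
    | VertexKind.player1 => ⨆ v' ∈ G.post v, ((G.r v : ℝ≥0∞) + f v')
    | VertexKind.player2 => ⨅ v' ∈ G.post v, ((G.r v : ℝ≥0∞) + f v')
    | VertexKind.random => (G.r v : ℝ≥0∞) + ∑ v', (G.δ v v' : ℝ≥0∞) * f v'

variable [MeasurableSpace V] [DiscreteMeasurableSpace V]

/-- The expected total reward; it may be infinite. -/
noncomputable def expRew (σ₁ : G.Strategy1) (σ₂ : G.Strategy2) (v : V) : ℝ≥0∞ :=
  ∫⁻ ω, G.rew ω ∂(StochasticGame.prob σ₁ σ₂ v)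

/-- The value for Player 2 at `v`, Player 2 being restricted to fair strategies. -/
noncomputable def upperValue (v : V) : ℝ≥0∞ :=
  ⨅ σ₂ ∈ G.fairStrategies, ⨆ σ₁ : G.Strategy1, G.expRew σ₁ σ₂ v

/-- The value for Player 1 at `v`, Player 2 being restricted to fair strategies. -/
noncomputable def lowerValue (v : V) : ℝ≥0∞ :=
  ⨆ σ₁ : G.Strategy1, ⨅ σ₂ ∈ G.fairStrategies, G.expRew σ₁ σ₂ v

/-- The bound `U`: the maximum over the vertices of the inf-sup over deterministic memoryless
strategies, fair for Player 2. -/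
noncomputable def bound : ℝ≥0∞ :=
  ⨆ v : V, ⨅ σ₂ ∈ G.detMemorylessFair2, ⨆ σ₁ ∈ G.detMemoryless1, G.expRew σ₁ σ₂ v

/-- The fixed points of the Bellman functional in `[0, U]^V`. -/
def bellmanFixedPoints : Set (V → ℝ≥0∞) :=
  {f | (∀ v, f v ≤ G.bound) ∧ G.bellman f = f}

end RewardGame

/-!
Let `S` contain the terminal vertices and every vertex from which the next vertex lies in `S`,
surely if Player 1 moves, possibly if Player 2 or chance does. From outside `S` Player 1 can then
avoid termination for ever, so `S` is everything. Hence so is the attractor of the terminal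
vertices, and the rank in it yields a finite potential `g` whose expectation drops in each step by
at least any prescribed constant when Player 2 always moves to a successor of least rank. For a
constant above all rewards this gives `Γ g ≤ g`, so the iterates `Γⁿ g` decrease to a fixed point
`f` of the continuous functional `Γ`.

Player 2 guarantees `Γⁿ g` by minimizing the successive iterates for `n` steps and descending in
rank ever after, which is fair because it terminates almost surely. Conversely, let `f'` be finite
with `f' ≤ Γ f'`, and let Player 1 always move to a maximizer of `f'`. Then `f' v` is at most the
reward expected up to time `n` plus `𝔼 f' (ω n)`, and the second term tends to `0` against every
fair strategy because `f'` vanishes at the terminal vertices. So `f'` lies below the lower value,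
which is at most the upper value, which is at most `f`; and `f' = f` shows that these are equal.
-/

section Trajectories

variable {X : ℕ → Type*} [∀ n, MeasurableSpace (X n)]
  {κ : (n : ℕ) → Kernel ((i : Finset.Iic n) → X i) (X (n + 1))} [∀ n, IsMarkovKernel (κ n)]
  {a n : ℕ}

theorem map_frestrictLe_traj_self (x : (i : Finset.Iic a) → X i) :
    (Kernel.traj κ a x).map (Preorder.frestrictLe a) = Measure.dirac x := by
  rw [Kernel.traj_map_frestrictLe_apply, Kernel.partialTraj_self, Kernel.id_apply]

theorem compProd_map_frestrictLe_traj (han : a ≤ n) (x : (i : Finset.Iic a) → X i) :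
    (Kernel.traj κ a x).map (Preorder.frestrictLe n) ⊗ₘ κ n =
      (Kernel.traj κ a x).map fun ω => (Preorder.frestrictLe n ω, ω (n + 1)) := by
  rw [Kernel.traj_map_frestrictLe_apply, Kernel.partialTraj_compProd_eq_map_traj han]

theorem lintegral_traj_succ (han : a ≤ n) (x : (i : Finset.Iic a) → X i) {f : X (n + 1) → ℝ≥0∞}
    (hf : Measurable f) :
    ∫⁻ ω, f (ω (n + 1)) ∂Kernel.traj κ a x =
      ∫⁻ ω, ∫⁻ y, f y ∂κ n (Preorder.frestrictLe n ω) ∂Kernel.traj κ a x := by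
  have hpair : Measurable fun ω : (n : ℕ) → X n => (Preorder.frestrictLe (π := X) n ω, ω (n + 1)) :=
    (Preorder.measurable_frestrictLe n).prodMk (measurable_pi_apply _)
  have hf_snd : Measurable fun z : ((i : Finset.Iic n) → X i) × X (n + 1) => f z.2 :=
    hf.comp measurable_snd
  calc ∫⁻ ω, f (ω (n + 1)) ∂Kernel.traj κ a x
    _ = ∫⁻ z, f z.2 ∂(Kernel.traj κ a x).map fun ω => (Preorder.frestrictLe n ω, ω (n + 1)) :=
        (lintegral_map hf_snd hpair).symm
    _ = ∫⁻ z, f z.2 ∂((Kernel.traj κ a x).map (Preorder.frestrictLe n) ⊗ₘ κ n) := by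
        rw [compProd_map_frestrictLe_traj han]
    _ = ∫⁻ y, ∫⁻ w, f w ∂κ n y ∂(Kernel.traj κ a x).map (Preorder.frestrictLe n) :=
        Measure.lintegral_compProd hf_snd
    _ = ∫⁻ ω, ∫⁻ y, f y ∂κ n (Preorder.frestrictLe n ω) ∂Kernel.traj κ a x :=
        lintegral_map hf.lintegral_kernel (Preorder.measurable_frestrictLe n)

theorem ae_traj_succ (han : a ≤ n) (x : (i : Finset.Iic a) → X i)
    {p : ((i : Finset.Iic n) → X i) → X (n + 1) → Prop}
    (hpm : MeasurableSet {z : ((i : Finset.Iic n) → X i) × X (n + 1) | p z.1 z.2})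
    (hp : ∀ y, ∀ᵐ w ∂κ n y, p y w) :
    ∀ᵐ ω ∂Kernel.traj κ a x, p (Preorder.frestrictLe n ω) (ω (n + 1)) := by
  have h : ∀ᵐ z ∂((Kernel.traj κ a x).map (Preorder.frestrictLe n) ⊗ₘ κ n), p z.1 z.2 :=
    Measure.ae_compProd_of_ae_ae hpm (ae_of_all _ hp)
  rw [compProd_map_frestrictLe_traj han x] at h
  exact ae_of_ae_map
    ((Preorder.measurable_frestrictLe n).prodMk (measurable_pi_apply _)).aemeasurable h

end Trajectories

theorem lintegral_toMeasure_pure {α : Type*} [MeasurableSpace α] [MeasurableSingletonClass α]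
    (a : α) (f : α → ℝ≥0∞) : ∫⁻ b, f b ∂(PMF.pure a).toMeasure = f a := by
  rw [PMF.toMeasure_pure, lintegral_dirac]

section Bounds

theorem tsum_le_of_add_succ_le {a b : ℕ → ℝ≥0∞} (h : ∀ n, b n + a (n + 1) ≤ a n) :
    ∑' n, b n ≤ a 0 := by
  have hsum : ∀ n, ∑ k ∈ Finset.range n, b k + a n ≤ a 0 := by
    intro n
    induction n with
    | zero => simp
    | succ n ih =>
      rw [Finset.sum_range_succ, add_assoc]
      exact (add_le_add_right (h n) _).trans ih
  exact ENNReal.tsum_le_of_sum_range_le fun n => le_self_add.trans (hsum n)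

theorem exists_ne_top_forall_le {ι : Type*} [Finite ι] {f : ι → ℝ≥0∞} (hf : ∀ i, f i ≠ ⊤) :
    ∃ C ≠ ⊤, ∀ i, f i ≤ C := by
  cases nonempty_fintype ι
  exact ⟨∑ i, f i, ENNReal.sum_ne_top.2 fun i _ => hf i,
    fun i => Finset.single_le_sum_of_canonicallyOrdered (Finset.mem_univ i)⟩

theorem two_mul_pow_rank_le_lintegral {α : Type*} [MeasurableSpace α] {rk : α → ℕ}
    (hrk : Measurable rk) {p : ℝ≥0∞} (hp : p ≠ 0) (hp1 : p ≤ 1) {a : α} {μ : Measure α}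
    (hpμ : p ≤ μ {b | rk b < rk a}) :
    2 * (p / 2) ^ rk a ≤ ∫⁻ b, (p / 2) ^ rk b ∂μ := by
  obtain ⟨k, hk⟩ : ∃ k, rk a = k + 1 := by
    refine Nat.exists_eq_succ_of_ne_zero fun h0 => hp ?_
    simpa [h0] using hpμ
  calc 2 * (p / 2) ^ rk a = (p / 2) ^ k * p := by
        rw [hk, pow_succ, mul_left_comm, ENNReal.mul_div_cancel two_ne_zero ENNReal.ofNat_ne_top]
    _ ≤ (p / 2) ^ k * μ {b | (p / 2) ^ k ≤ (p / 2) ^ rk b} := by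
        refine mul_le_mul_right (hpμ.trans (measure_mono fun b hb => ?_)) _
        exact pow_le_pow_right_of_le_one' (ENNReal.half_le_self.trans hp1)
          (Nat.lt_succ_iff.1 (hb.trans_eq hk))
    _ ≤ ∫⁻ b, (p / 2) ^ rk b ∂μ :=
        mul_meas_ge_le_lintegral
          ((measurable_of_countable fun k : ℕ => (p / 2) ^ k).comp hrk) _

-- The potential is `C * (1 - (p / 2) ^ rk a)`: if the rank decreases with probability at least `p`,
-- then the expectation of `(p / 2) ^ rk` at least doubles, so the potential drops by at least
-- `C * (p / 2) ^ rk a`, which is at least `C * (p / 2) ^ N = R`.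
theorem exists_potential_of_rank {α : Type*} [MeasurableSpace α] {rk : α → ℕ} (hrk : Measurable rk)
    {N : ℕ} (hN : ∀ a, rk a ≤ N) {p R : ℝ≥0∞} (hp : p ≠ 0) (hp1 : p ≤ 1) (hR : R ≠ ⊤) :
    ∃ g : α → ℝ≥0∞, (∀ a, g a ≠ ⊤) ∧ (∀ a, rk a = 0 → g a = 0) ∧
      ∀ (a : α) (μ : Measure α) [IsProbabilityMeasure μ], p ≤ μ {b | rk b < rk a} →
        R + ∫⁻ b, g b ∂μ ≤ g a := by
  have ht0 : p / 2 ≠ 0 := ENNReal.div_ne_zero.2 ⟨hp, ENNReal.ofNat_ne_top⟩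
  have ht1 : p / 2 ≤ 1 := ENNReal.half_le_self.trans hp1
  have ht_top : p / 2 ≠ ⊤ := ne_top_of_le_ne_top ENNReal.one_ne_top ht1
  set C : ℝ≥0∞ := R / (p / 2) ^ N
  have hC_top : C ≠ ⊤ := ENNReal.div_ne_top hR (pow_ne_zero N ht0)
  set u : α → ℝ≥0∞ := fun a => C * (p / 2) ^ rk a with hu
  have huC (a : α) : u a ≤ C := mul_le_of_le_one_right' (pow_le_one' ht1 _)
  have hRu (a : α) : R ≤ u a := by
    calc R = C * (p / 2) ^ N :=
          (ENNReal.div_mul_cancel (pow_ne_zero N ht0) (ENNReal.pow_ne_top ht_top)).symm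
      _ ≤ u a := mul_le_mul_right (pow_le_pow_right_of_le_one' ht1 (hN a)) C
  have hpow : Measurable fun a => (p / 2) ^ rk a :=
    (measurable_of_countable fun k : ℕ => (p / 2) ^ k).comp hrk
  refine ⟨fun a => C - u a, fun a => ENNReal.sub_ne_top hC_top, fun a ha => by simp [hu, ha],
    fun a μ _ hpμ => ?_⟩
  have hdouble : 2 * u a ≤ ∫⁻ b, u b ∂μ := by
    rw [lintegral_const_mul _ hpow, mul_left_comm]
    exact mul_le_mul_right (two_mul_pow_rank_le_lintegral hrk hp hp1 hpμ) C
  refine (ENNReal.add_le_add_iff_right (ne_top_of_le_ne_top hC_top (huC a))).1 ?_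
  calc R + ∫⁻ b, C - u b ∂μ + u a ≤ 2 * u a + ∫⁻ b, C - u b ∂μ := by
        rw [two_mul, add_right_comm]
        exact add_le_add_left (add_le_add_left (hRu a) _) _
    _ ≤ ∫⁻ b, u b ∂μ + ∫⁻ b, C - u b ∂μ := add_le_add_left hdouble _
    _ = C := by
        rw [← lintegral_add_left (hpow.const_mul C)]
        calc ∫⁻ b, u b + (C - u b) ∂μ = ∫⁻ _, C ∂μ :=
              lintegral_congr fun b => add_tsub_cancel_of_le (huC b)
          _ = C := by simp
    _ = C - u a + u a := (tsub_add_cancel_of_le (huC a)).symm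

end Bounds

namespace StochasticGame

section Moves

variable {V : Type*} [Fintype V] {G : StochasticGame V}

theorem step_player1 (σ₁ : G.Strategy1) (σ₂ : G.Strategy2) (h : List V) {v : V}
    (hv : G.kind v = VertexKind.player1) : step σ₁ σ₂ h v = σ₁.move h ⟨v, hv⟩ := by
  unfold step
  split <;> first | rfl | (rename_i hv'; cases hv.symm.trans hv')

theorem step_player2 (σ₁ : G.Strategy1) (σ₂ : G.Strategy2) (h : List V) {v : V}
    (hv : G.kind v = VertexKind.player2) : step σ₁ σ₂ h v = σ₂.move h ⟨v, hv⟩ := by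
  unfold step
  split <;> first | rfl | (rename_i hv'; cases hv.symm.trans hv')

theorem step_random (σ₁ : G.Strategy1) (σ₂ : G.Strategy2) (h : List V) {v : V}
    (hv : G.kind v = VertexKind.random) : step σ₁ σ₂ h v = G.randomStep v hv := by
  unfold step
  split <;> first | rfl | (rename_i hv'; cases hv.symm.trans hv')

theorem randomStep_apply {v : V} (hv : G.kind v = VertexKind.random) (v' : V) :
    G.randomStep v hv v' = G.δ v v' := rfl

theorem support_randomStep {v : V} (hv : G.kind v = VertexKind.random) :
    (G.randomStep v hv).support = G.post v := by
  ext v'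
  rw [PMF.mem_support_iff, randomStep_apply, ENNReal.coe_ne_zero, ← pos_iff_ne_zero]
  rfl

theorem support_step_subset (σ₁ : G.Strategy1) (σ₂ : G.Strategy2) (h : List V) (v : V) :
    (step σ₁ σ₂ h v).support ⊆ G.post v := by
  rcases hv : G.kind v
  · rw [step_player1 _ _ _ hv]; exact σ₁.support_subset h ⟨v, hv⟩
  · rw [step_player2 _ _ _ hv]; exact σ₂.support_subset h ⟨v, hv⟩
  · rw [step_random _ _ _ hv, support_randomStep]

instance nonempty_post (v : V) : Nonempty (G.post v) :=
  Set.nonempty_coe_sort.2 (G.exists_succ v)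

theorem exists_argmin {β : Type*} [LinearOrder β] (G : StochasticGame V) (f : V → β) :
    ∃ c : ∀ v, G.post v, ∀ v, ∀ w ∈ G.post v, f (c v) ≤ f w := by
  choose c hc using fun v => Finite.exists_min fun w : G.post v => f w
  exact ⟨c, fun v w hw => hc v ⟨w, hw⟩⟩

theorem exists_argmax {β : Type*} [LinearOrder β] (G : StochasticGame V) (f : V → β) :
    ∃ c : ∀ v, G.post v, ∀ v, ∀ w ∈ G.post v, f w ≤ f (c v) :=
  G.exists_argmin (OrderDual.toDual ∘ f)

/-- The deterministic strategy that moves from `v` at time `n` to the successor `c n v`. -/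
noncomputable def Strategy.markov {i : VertexKind} (c : ℕ → ∀ v, G.post v) : G.Strategy i where
  move h v := PMF.pure (c h.length v : V)
  support_subset h v := by
    rw [PMF.support_pure, Set.singleton_subset_iff]
    exact (c h.length v).2

theorem Strategy.markov_move {i : VertexKind} (c : ℕ → ∀ v, G.post v) (h : List V)
    (v : {v : V // G.kind v = i}) :
    (Strategy.markov c : G.Strategy i).move h v = PMF.pure (c h.length v : V) := rfl

theorem Strategy.deterministic_markov {i : VertexKind} (c : ℕ → ∀ v, G.post v) :
    (Strategy.markov c : G.Strategy i).Deterministic :=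
  fun h v => ⟨c h.length v, rfl⟩

theorem Strategy.memoryless_markov_const {i : VertexKind} (c : ∀ v, G.post v) :
    (Strategy.markov (fun _ => c) : G.Strategy i).Memoryless :=
  fun _ _ => rfl

theorem eq_of_mem_post_terminal {v v' : V} (hv : v ∈ G.terminal) (hv' : v' ∈ G.post v) :
    v' = v := by
  by_contra hne
  have hpos : 0 < G.δ v v' := hv'
  exact hpos.ne' (hv.2 v' hne)

theorem eq_of_mem_terminal_of_le {ω : ℕ → V} (hω : ω ∈ G.paths) {n : ℕ}
    (hn : ω n ∈ G.terminal) (m : ℕ) (hm : n ≤ m) : ω m = ω n := by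
  induction m, hm using Nat.le_induction with
  | base => rfl
  | succ m _ ih => rw [← ih] at hn ⊢; exact eq_of_mem_post_terminal hn (hω m)

theorem mem_fairPaths_of_mem_terminal {ω : ℕ → V} (hω : ω ∈ G.paths) {n : ℕ}
    (hn : ω n ∈ G.terminal) : ω ∈ G.fairPaths := by
  refine ⟨hω, fun v _ hfreq v' hv' => ?_⟩
  obtain ⟨m, hm, rfl⟩ := (Filter.frequently_atTop.1 hfreq) n
  rw [eq_of_mem_terminal_of_le hω hn m hm] at hv' hfreq
  rw [eq_of_mem_post_terminal hn hv']
  exact hfreq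

theorem exists_seq_frequently_eq (v : V) :
    ∃ e : ℕ → G.post v, ∀ w : G.post v, ∃ᶠ k in Filter.atTop, e k = w := by
  obtain ⟨s, hs⟩ := exists_surjective_nat (G.post v)
  refine ⟨fun k => s k.unpair.1, fun w => ?_⟩
  obtain ⟨j, rfl⟩ := hs w
  exact Filter.frequently_atTop.2 fun a => ⟨Nat.pair j a, Nat.right_le_pair _ _, by simp⟩

end Moves

section History

variable {V : Type*}

/-- The vertices that a play visits before time `n`, in the order of the visits. -/
def history (ω : ℕ → V) (n : ℕ) : List V := List.ofFn fun k : Fin n => ω k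

theorem length_history (ω : ℕ → V) (n : ℕ) : (history ω n).length = n := List.length_ofFn

theorem count_history [DecidableEq V] (ω : ℕ → V) (v : V) (n : ℕ) :
    (history ω n).count v = Nat.count (fun k => ω k = v) n := by
  induction n with
  | zero => rfl
  | succ n ih =>
    have hsucc : history ω (n + 1) = history ω n ++ [ω n] := by
      rw [history, List.ofFn_succ', List.concat_eq_append]
      rfl
    rw [hsucc, List.count_append, Nat.count_succ, ih]
    simp only [List.count_singleton, beq_iff_eq]

end History

section Measurability

variable {V : Type*} [MeasurableSpace V] [DiscreteMeasurableSpace V]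

theorem measurable_comp_eval {β : Type*} [MeasurableSpace β] (f : V → β) (n : ℕ) :
    Measurable fun ω : ℕ → V => f (ω n) :=
  (Measurable.of_discrete (f := f)).comp (measurable_pi_apply n)

theorem measurable_frequently_eq (v : V) :
    Measurable fun ω : ℕ → V => ∃ᶠ n in Filter.atTop, ω n = v := by
  simp only [Filter.frequently_atTop]
  exact Measurable.forall fun _ => Measurable.exists fun n =>
    measurable_const.and (measurable_comp_eval (· = v) n)

end Measurability

section Plays

variable {V : Type*} [Fintype V] {G : StochasticGame V} [MeasurableSpace V]
  [DiscreteMeasurableSpace V]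

instance isProbabilityMeasure_prob (σ₁ : G.Strategy1) (σ₂ : G.Strategy2) (v : V) :
    IsProbabilityMeasure (prob σ₁ σ₂ v) := by
  unfold prob
  infer_instance

theorem ae_prob_zero (σ₁ : G.Strategy1) (σ₂ : G.Strategy2) (v : V) :
    ∀ᵐ ω ∂prob σ₁ σ₂ v, ω 0 = v := by
  have hdirac : (prob σ₁ σ₂ v).map (Preorder.frestrictLe (π := fun _ => V) 0) =
      Measure.dirac fun _ => v := map_frestrictLe_traj_self _
  refine ae_of_ae_map (f := Preorder.frestrictLe (π := fun _ => V) 0)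
    (p := fun x => x ⟨0, Finset.mem_Iic.2 le_rfl⟩ = v)
    (Preorder.measurable_frestrictLe 0).aemeasurable ?_
  rw [hdirac]
  exact (ae_dirac_iff MeasurableSet.of_discrete).2 rfl

theorem lintegral_prob_zero (σ₁ : G.Strategy1) (σ₂ : G.Strategy2) (v : V) (f : V → ℝ≥0∞) :
    ∫⁻ ω, f (ω 0) ∂prob σ₁ σ₂ v = f v := by
  calc ∫⁻ ω, f (ω 0) ∂prob σ₁ σ₂ v = ∫⁻ _, f v ∂prob σ₁ σ₂ v :=
        lintegral_congr_ae ((ae_prob_zero σ₁ σ₂ v).mono fun _ hω => congrArg f hω)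
    _ = f v := by simp

theorem lintegral_prob_succ (σ₁ : G.Strategy1) (σ₂ : G.Strategy2) (v : V) (f : V → ℝ≥0∞) (n : ℕ) :
    ∫⁻ ω, f (ω (n + 1)) ∂prob σ₁ σ₂ v =
      ∫⁻ ω, ∫⁻ w, f w ∂(step σ₁ σ₂ (history ω n) (ω n)).toMeasure ∂prob σ₁ σ₂ v :=
  lintegral_traj_succ (X := fun _ => V) (κ := stepKernel σ₁ σ₂) n.zero_le _
    (Measurable.of_discrete (f := f))

theorem lintegral_add_lintegral_prob_succ (σ₁ : G.Strategy1) (σ₂ : G.Strategy2) (v : V)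
    (b f : V → ℝ≥0∞) (n : ℕ) :
    ∫⁻ ω, b (ω n) ∂prob σ₁ σ₂ v + ∫⁻ ω, f (ω (n + 1)) ∂prob σ₁ σ₂ v =
      ∫⁻ ω, b (ω n) + ∫⁻ w, f w ∂(step σ₁ σ₂ (history ω n) (ω n)).toMeasure ∂prob σ₁ σ₂ v := by
  rw [lintegral_prob_succ, lintegral_add_left (measurable_comp_eval b n)]

theorem ae_prob_mem_support (σ₁ : G.Strategy1) (σ₂ : G.Strategy2) (v : V) :
    ∀ᵐ ω ∂prob σ₁ σ₂ v, ∀ n, ω (n + 1) ∈ (step σ₁ σ₂ (history ω n) (ω n)).support :=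
  ae_all_iff.2 fun n => ae_traj_succ (X := fun _ => V) (κ := stepKernel σ₁ σ₂) n.zero_le _
    (p := fun x w => w ∈ (step σ₁ σ₂ (List.ofFn fun k : Fin n => x ⟨k, Finset.mem_Iic.2 k.isLt.le⟩)
      (x ⟨n, Finset.mem_Iic.2 le_rfl⟩)).support)
    MeasurableSet.of_discrete fun _ =>
      (mem_ae_iff_prob_eq_one MeasurableSet.of_discrete).2
        ((PMF.toMeasure_apply_eq_one_iff _ MeasurableSet.of_discrete).2 subset_rfl)

theorem ae_prob_mem_paths (σ₁ : G.Strategy1) (σ₂ : G.Strategy2) (v : V) :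
    ∀ᵐ ω ∂prob σ₁ σ₂ v, ω ∈ G.paths := by
  filter_upwards [ae_prob_mem_support σ₁ σ₂ v] with ω hω k
  exact support_step_subset _ _ _ _ (hω k)

theorem measurableSet_paths : MeasurableSet G.paths := by
  refine measurableSet_setOfPred.2 (Measurable.forall fun k => ?_)
  have hedge : Measurable fun z : V × V => 0 < G.δ z.1 z.2 := Measurable.of_discrete
  exact hedge.comp (f := fun ω : ℕ → V => (ω k, ω (k + 1)))
    ((measurable_pi_apply k).prodMk (measurable_pi_apply (k + 1)))

theorem measurableSet_fairPaths : MeasurableSet G.fairPaths := by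
  have := Finite.to_countable (α := V)
  exact measurableSet_paths.inter <| measurableSet_setOfPred.2 <| Measurable.forall fun v =>
    measurable_const.imp <| (measurable_frequently_eq v).imp <| Measurable.forall fun v' =>
      measurable_const.imp (measurable_frequently_eq v')

theorem measurableSet_reachTerminal : MeasurableSet G.reachTerminal :=
  measurableSet_paths.inter <| measurableSet_setOfPred.2 <| Measurable.exists fun n =>
    measurable_comp_eval (· ∈ G.terminal) n

theorem mem_fairStrategies_iff {σ₂ : G.Strategy2} :
    σ₂ ∈ G.fairStrategies ↔
      ∀ (σ₁ : G.Strategy1) (v : V), ∀ᵐ ω ∂prob σ₁ σ₂ v, ω ∈ G.fairPaths :=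
  forall₂_congr fun _ _ => (mem_ae_iff_prob_eq_one measurableSet_fairPaths).symm

theorem StoppingUnderFairness.ae_eventually_mem_terminal (hG : G.StoppingUnderFairness)
    (σ₁ : G.Strategy1) {σ₂ : G.Strategy2} (hσ₂ : σ₂ ∈ G.fairStrategies) (v : V) :
    ∀ᵐ ω ∂prob σ₁ σ₂ v, ∀ᶠ n in Filter.atTop, ω n ∈ G.terminal := by
  filter_upwards [(mem_ae_iff_prob_eq_one measurableSet_reachTerminal).2 (hG σ₁ σ₂ hσ₂ v)]
    with ω ⟨hω, n, hn⟩
  filter_upwards [Filter.eventually_ge_atTop n] with m hm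
  rwa [eq_of_mem_terminal_of_le hω hn m hm]

variable (G) in
open Classical in
-- Player 2 cycles through the successors of each of her vertices: the `k`-th visit is followed by
-- the `k`-th term of a sequence that takes every value infinitely often.
theorem nonempty_fairStrategies : G.fairStrategies.Nonempty := by
  choose e he using G.exists_seq_frequently_eq
  refine ⟨⟨fun h v => PMF.pure (e v (h.count v.1) : V), fun h v => ?_⟩, ?_⟩
  · rw [PMF.support_pure, Set.singleton_subset_iff]
    exact (e v.1 _).2
  rw [mem_fairStrategies_iff]
  intro σ₁ v
  filter_upwards [ae_prob_mem_paths σ₁ _ v, ae_prob_mem_support σ₁ _ v] with ω hω hsupp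
  refine ⟨hω, fun w hw hfreq w' hw' => Filter.frequently_atTop.2 fun a => ?_⟩
  obtain ⟨k, hk, hek⟩ := Filter.frequently_atTop.1 (he w ⟨w', hw'⟩) a
  have hinf : {n | ω n = w}.Infinite := Nat.frequently_atTop_iff_infinite.1 hfreq
  set m := Nat.nth (fun n => ω n = w) k with hm
  have hωm : ω m = w := Nat.nth_mem_of_infinite hinf k
  have hkm : k ≤ m := (Nat.nth_strictMono hinf).le_apply
  have hcount : (history ω m).count w = k := by
    rw [count_history, hm, Nat.count_nth_of_infinite hinf]
  have hnext : ω (m + 1) = e w ((history ω m).count w) := by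
    simpa [hωm, step_player2 _ _ _ hw] using hsupp m
  exact ⟨m + 1, by lia, by rw [hnext, hcount, hek]⟩

end Plays

end StochasticGame

namespace StochasticGame

section Attractor

variable {V : Type*} [Fintype V] (G : StochasticGame V)

/-- The vertices from which the next vertex lies in `S`, surely when Player 1 moves, for a suitable
choice when Player 2 moves, and with positive probability when chance moves. -/
def controllablePre (S : Set V) : Set V :=
  {v | (G.kind v = VertexKind.player1 → G.post v ⊆ S) ∧
    (G.kind v ≠ VertexKind.player1 → (G.post v ∩ S).Nonempty)}

theorem controllablePre_mono : Monotone G.controllablePre := fun _ _ hST _ hv =>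
  ⟨fun hk => (hv.1 hk).trans hST, fun hk => (hv.2 hk).mono (Set.inter_subset_inter_right _ hST)⟩

/-- The vertices from which Player 2, helped by chance, can reach a terminal vertex within `n`
steps whatever Player 1 does. -/
def attractor : ℕ →o Set V where
  toFun := Nat.rec G.terminal fun _ S => S ∪ G.controllablePre S
  monotone' := monotone_nat_of_le_succ fun _ => Set.subset_union_left

theorem attractor_zero : G.attractor 0 = G.terminal := rfl

theorem attractor_succ (n : ℕ) :
    G.attractor (n + 1) = G.attractor n ∪ G.controllablePre (G.attractor n) := rfl

theorem exists_controllablePre_attractor_subset :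
    ∃ n, G.controllablePre (G.attractor n) ⊆ G.attractor n := by
  obtain ⟨n, hn⟩ := WellFoundedGT.monotone_chain_condition G.attractor
  have hstable : G.attractor n = G.attractor (n + 1) := hn (n + 1) n.le_succ
  rw [attractor_succ] at hstable
  exact ⟨n, Set.subset_union_right.trans hstable.ge⟩

theorem exists_pos_le_δ :
    ∃ p : ℝ≥0, 0 < p ∧ p ≤ 1 ∧ ∀ v, ∀ w ∈ G.post v, p ≤ G.δ v w := by
  have hδ : ∀ᶠ p in nhdsWithin (0 : ℝ≥0) (Set.Ioi 0), ∀ v, ∀ w ∈ G.post v, p ≤ G.δ v w :=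
    Filter.eventually_all.2 fun v => Filter.eventually_all.2 fun w =>
      Filter.eventually_imp_distrib_left.2 fun hw =>
        Filter.mem_of_superset (Ioc_mem_nhdsGT hw) fun _ hp => hp.2
  obtain ⟨p, hp, hpos, hp1⟩ := (hδ.and (Ioc_mem_nhdsGT one_pos)).exists
  exact ⟨p, hpos, hp1, hp⟩

end Attractor

section Rank

variable {V : Type*} [Fintype V] {G : StochasticGame V} [MeasurableSpace V]
  [DiscreteMeasurableSpace V]

theorem StoppingUnderFairness.eq_univ_of_controllablePre_subset (hG : G.StoppingUnderFairness)
    {S : Set V} (hT : G.terminal ⊆ S) (hS : G.controllablePre S ⊆ S) : S = Set.univ := by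
  refine Set.eq_univ_of_forall fun v => by_contra fun hv => ?_
  obtain ⟨c, hc⟩ := G.exists_argmin (· ∈ S)
  obtain ⟨σ₂, hσ₂⟩ := G.nonempty_fairStrategies
  have hstay (l : List V) (v : V) (hv : v ∉ S) (w : V)
      (hw : w ∈ (step (Strategy.markov fun _ => c) σ₂ l v).support) : w ∉ S := by
    intro hwS
    refine hv (hS ⟨fun hk w' hw' => ?_, fun _ => ⟨w, support_step_subset _ _ _ _ hw, hwS⟩⟩)
    rw [step_player1 _ _ _ hk, Strategy.markov_move, PMF.support_pure,
      Set.mem_singleton_iff] at hw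
    exact hc v w' hw' (hw ▸ hwS)
  have hfalse : ∀ᵐ _ ∂prob (Strategy.markov fun _ => c) σ₂ v, False := by
    filter_upwards [hG.ae_eventually_mem_terminal _ hσ₂ v, ae_prob_zero _ σ₂ v,
      ae_prob_mem_support _ σ₂ v] with ω hT' hzero hsupp
    have hout (n : ℕ) : ω n ∉ S := by
      induction n with
      | zero => rwa [hzero]
      | succ n ih => exact hstay _ _ ih _ (hsupp n)
    obtain ⟨n, hn⟩ := hT'.exists
    exact hout n (hT hn)
  exact hfalse.exists.elim fun _ h => h

theorem StoppingUnderFairness.exists_rank (hG : G.StoppingUnderFairness) :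
    ∃ rk : V → ℕ, (∀ v ∈ G.terminal, rk v = 0) ∧
      ∀ v ∉ G.terminal, v ∈ G.controllablePre {w | rk w < rk v} := by
  obtain ⟨N, hN⟩ := G.exists_controllablePre_attractor_subset
  have hall : G.attractor N = Set.univ :=
    hG.eq_univ_of_controllablePre_subset (G.attractor.monotone N.zero_le) hN
  set rk : V → ℕ := fun v => sInf {n | v ∈ G.attractor n}
  have hmem (v : V) : v ∈ G.attractor (rk v) :=
    Nat.sInf_mem (s := {n | v ∈ G.attractor n}) ⟨N, hall.ge (Set.mem_univ v)⟩
  have hle {v : V} {n : ℕ} (hv : v ∈ G.attractor n) : rk v ≤ n := Nat.sInf_le hv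
  refine ⟨rk, fun v hv => Nat.le_zero.1 (hle hv), fun v hv => ?_⟩
  obtain ⟨n, hn⟩ : ∃ n, rk v = n + 1 :=
    Nat.exists_eq_succ_of_ne_zero fun h0 => hv (by simpa [h0, attractor_zero] using hmem v)
  have hsucc : v ∈ G.attractor n ∪ G.controllablePre (G.attractor n) := by
    rw [← attractor_succ, ← hn]; exact hmem v
  have hnot : v ∉ G.attractor n := fun h => by have := hle h; lia
  refine G.controllablePre_mono (fun w hw => ?_) (hsucc.resolve_left hnot)
  exact (Nat.lt_succ_of_le (hle hw)).trans_eq hn.symm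

end Rank

section Potential

variable {V : Type*} [Fintype V] {G : StochasticGame V} [MeasurableSpace V]

/-- A potential `g` that vanishes at the terminal vertices and whose expectation drops by at least
`R` in each step from a non-terminal vertex, as long as Player 2 moves according to `c`. -/
structure IsPotential (G : StochasticGame V) (R : ℝ≥0∞) (c : ∀ v, G.post v) (g : V → ℝ≥0∞) :
    Prop where
  ne_top : ∀ v, g v ≠ ⊤
  eq_zero : ∀ v ∈ G.terminal, g v = 0
  add_lintegral_le : ∀ (σ₁ : G.Strategy1) (σ₂ : G.Strategy2) (l : List V),
    (∀ v, σ₂.move l v = PMF.pure (c v : V)) → ∀ v ∉ G.terminal,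
      R + ∫⁻ w, g w ∂(step σ₁ σ₂ l v).toMeasure ≤ g v

variable [DiscreteMeasurableSpace V]

theorem toMeasure_step_eq_one {σ₁ : G.Strategy1} {σ₂ : G.Strategy2} {l : List V} {v : V} {S : Set V}
    (hS : (step σ₁ σ₂ l v).support ⊆ S) : (step σ₁ σ₂ l v).toMeasure S = 1 :=
  (PMF.toMeasure_apply_eq_one_iff _ MeasurableSet.of_discrete).2 hS

theorem le_toMeasure_step_of_mem_controllablePre {p : ℝ≥0} (hp1 : p ≤ 1)
    (hp : ∀ v, ∀ w ∈ G.post v, p ≤ G.δ v w) {σ₁ : G.Strategy1} {σ₂ : G.Strategy2} {l : List V}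
    {v : V} {S : Set V} (hv : v ∈ G.controllablePre S)
    (hσ₂ : ∀ hk : G.kind v = VertexKind.player2, (σ₂.move l ⟨v, hk⟩).support ⊆ S) :
    (p : ℝ≥0∞) ≤ (step σ₁ σ₂ l v).toMeasure S := by
  rcases hk : G.kind v
  · rw [toMeasure_step_eq_one ((support_step_subset _ _ _ _).trans (hv.1 hk))]
    exact_mod_cast hp1
  · rw [toMeasure_step_eq_one (by rw [step_player2 _ _ _ hk]; exact hσ₂ hk)]
    exact_mod_cast hp1
  · obtain ⟨w, hw, hwS⟩ := hv.2 (by simp [hk])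
    calc (p : ℝ≥0∞) ≤ G.δ v w := by exact_mod_cast hp v w hw
      _ = (step σ₁ σ₂ l v).toMeasure {w} := by
          rw [PMF.toMeasure_apply_singleton _ _ (measurableSet_singleton w), step_random _ _ _ hk,
            randomStep_apply]
      _ ≤ (step σ₁ σ₂ l v).toMeasure S := measure_mono (Set.singleton_subset_iff.2 hwS)

theorem StoppingUnderFairness.exists_isPotential (hG : G.StoppingUnderFairness) {R : ℝ≥0∞}
    (hR : R ≠ ⊤) : ∃ c g, G.IsPotential R c g := by
  obtain ⟨rk, hzero, hpre⟩ := hG.exists_rank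
  obtain ⟨p, hp0, hp1, hp⟩ := G.exists_pos_le_δ
  obtain ⟨c, hc⟩ := G.exists_argmin rk
  obtain ⟨g, hg_top, hg_zero, hg⟩ := exists_potential_of_rank (Measurable.of_discrete (f := rk))
    (fun v => Finset.le_sup (f := rk) (Finset.mem_univ v)) (p := p)
    (by exact_mod_cast hp0.ne') (by exact_mod_cast hp1) hR
  refine ⟨c, g, hg_top, fun v hv => hg_zero v (hzero v hv), fun σ₁ σ₂ l hσ₂ v hv => ?_⟩
  refine hg v _ (le_toMeasure_step_of_mem_controllablePre hp1 hp (hpre v hv) fun hk => ?_)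
  obtain ⟨w, hw, hlt⟩ := (hpre v hv).2 (by simp [hk])
  rw [hσ₂, PMF.support_pure, Set.singleton_subset_iff]
  exact (hc v w hw).trans_lt hlt

theorem ae_step_mem_post (σ₁ : G.Strategy1) (σ₂ : G.Strategy2) (l : List V) (v : V) :
    ∀ᵐ w ∂(step σ₁ σ₂ l v).toMeasure, w ∈ G.post v :=
  (mem_ae_iff_prob_eq_one MeasurableSet.of_discrete).2
    (toMeasure_step_eq_one (support_step_subset σ₁ σ₂ l v))

theorem lintegral_step_of_mem_terminal (σ₁ : G.Strategy1) (σ₂ : G.Strategy2) (l : List V) {v : V}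
    (hv : v ∈ G.terminal) (f : V → ℝ≥0∞) : ∫⁻ w, f w ∂(step σ₁ σ₂ l v).toMeasure = f v := by
  calc ∫⁻ w, f w ∂(step σ₁ σ₂ l v).toMeasure = ∫⁻ _, f v ∂(step σ₁ σ₂ l v).toMeasure :=
        lintegral_congr_ae ((ae_step_mem_post σ₁ σ₂ l v).mono fun w hw =>
          congrArg f (eq_of_mem_post_terminal hv hw))
    _ = f v := by simp

theorem IsPotential.indicator_add_lintegral_le {R : ℝ≥0∞} {c : ∀ v, G.post v} {g : V → ℝ≥0∞}
    (hg : G.IsPotential R c g) (σ₁ : G.Strategy1) {σ₂ : G.Strategy2} {l : List V}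
    (hσ₂ : ∀ v, σ₂.move l v = PMF.pure (c v : V)) (v : V) :
    G.terminalᶜ.indicator (fun _ => R) v + ∫⁻ w, g w ∂(step σ₁ σ₂ l v).toMeasure ≤ g v := by
  by_cases hv : v ∈ G.terminal
  · rw [lintegral_step_of_mem_terminal _ _ _ hv, Set.indicator_of_notMem (not_not.2 hv), zero_add]
  · rw [Set.indicator_of_mem hv]
    exact hg.add_lintegral_le σ₁ σ₂ l hσ₂ v hv

theorem IsPotential.tsum_prob_notMem_terminal_le {R : ℝ≥0∞} {c : ∀ v, G.post v} {g : V → ℝ≥0∞}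
    (hg : G.IsPotential R c g) (σ₁ : G.Strategy1) {e : ℕ → ∀ v, G.post v} {n : ℕ}
    (he : ∀ k, e (n + k) = c) (v : V) :
    ∑' k, R * prob σ₁ (Strategy.markov e) v {ω | ω (n + k) ∉ G.terminal} ≤
      ∫⁻ ω, g (ω n) ∂prob σ₁ (Strategy.markov e) v := by
  refine tsum_le_of_add_succ_le
    (a := fun k => ∫⁻ ω, g (ω (n + k)) ∂prob σ₁ (Strategy.markov e) v) fun k => ?_
  have hmeas : MeasurableSet {ω : ℕ → V | ω (n + k) ∉ G.terminal} :=
    measurableSet_setOfPred.2 (measurable_comp_eval (· ∉ G.terminal) (n + k))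
  calc R * prob σ₁ (Strategy.markov e) v {ω | ω (n + k) ∉ G.terminal} +
        ∫⁻ ω, g (ω (n + (k + 1))) ∂prob σ₁ (Strategy.markov e) v
    _ = ∫⁻ ω, G.terminalᶜ.indicator (fun _ => R) (ω (n + k)) ∂prob σ₁ (Strategy.markov e) v +
        ∫⁻ ω, g (ω (n + k + 1)) ∂prob σ₁ (Strategy.markov e) v := by
        rw [← lintegral_indicator_const hmeas]
        rfl
    _ ≤ ∫⁻ ω, g (ω (n + k)) ∂prob σ₁ (Strategy.markov e) v := by
        rw [lintegral_add_lintegral_prob_succ]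
        refine lintegral_mono fun ω => hg.indicator_add_lintegral_le σ₁ (fun w => ?_) _
        rw [Strategy.markov_move, length_history, he]

theorem IsPotential.markov_mem_fairStrategies {R : ℝ≥0∞} (hR : R ≠ 0) {c : ∀ v, G.post v}
    {g : V → ℝ≥0∞} (hg : G.IsPotential R c g) {e : ℕ → ∀ v, G.post v} {n : ℕ}
    (he : ∀ k, e (n + k) = c) : Strategy.markov e ∈ G.fairStrategies := by
  refine mem_fairStrategies_iff.2 fun σ₁ v => ?_
  obtain ⟨C, hC_top, hgC⟩ := exists_ne_top_forall_le hg.ne_top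
  have hfin : ∫⁻ ω, g (ω n) ∂prob σ₁ (Strategy.markov e) v ≠ ⊤ :=
    ne_top_of_le_ne_top hC_top ((lintegral_mono fun _ => hgC _).trans_eq (by simp))
  have hsum := ne_top_of_le_ne_top hfin (hg.tsum_prob_notMem_terminal_le σ₁ he v)
  rw [ENNReal.tsum_mul_left] at hsum
  have hBC := ae_eventually_notMem (ENNReal.lt_top_of_mul_ne_top_right hsum hR |>.ne)
  filter_upwards [hBC, ae_prob_mem_paths σ₁ _ v] with ω hω hpath
  obtain ⟨k, hk⟩ := hω.exists
  exact mem_fairPaths_of_mem_terminal hpath (not_not.1 hk)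

end Potential

end StochasticGame

namespace RewardGame

open StochasticGame

section Bellman

variable {V : Type*} [Fintype V] {G : RewardGame V}

theorem bellman_terminal (f : V → ℝ≥0∞) {v : V} (hv : v ∈ G.terminal) : G.bellman f v = 0 :=
  if_pos hv

theorem bellman_player1 (f : V → ℝ≥0∞) {v : V} (hv : v ∉ G.terminal)
    (hk : G.kind v = VertexKind.player1) :
    G.bellman f v = ⨆ w ∈ G.post v, ((G.r v : ℝ≥0∞) + f w) := by
  simp only [bellman, if_neg hv, hk]

theorem bellman_player2 (f : V → ℝ≥0∞) {v : V} (hv : v ∉ G.terminal)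
    (hk : G.kind v = VertexKind.player2) :
    G.bellman f v = ⨅ w ∈ G.post v, ((G.r v : ℝ≥0∞) + f w) := by
  simp only [bellman, if_neg hv, hk]

theorem bellman_random (f : V → ℝ≥0∞) {v : V} (hv : v ∉ G.terminal)
    (hk : G.kind v = VertexKind.random) :
    G.bellman f v = (G.r v : ℝ≥0∞) + ∑ w, (G.δ v w : ℝ≥0∞) * f w := by
  simp only [bellman, if_neg hv, hk]

theorem bellman_mono : Monotone G.bellman := by
  intro f g hfg v
  by_cases hv : v ∈ G.terminal
  · rw [bellman_terminal f hv, bellman_terminal g hv]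
  rcases hk : G.kind v
  · rw [bellman_player1 f hv hk, bellman_player1 g hv hk]
    exact iSup₂_mono fun w _ => add_le_add_right (hfg w) _
  · rw [bellman_player2 f hv hk, bellman_player2 g hv hk]
    exact iInf₂_mono fun w _ => add_le_add_right (hfg w) _
  · rw [bellman_random f hv hk, bellman_random g hv hk]
    exact add_le_add_right (Finset.sum_le_sum fun w _ => mul_le_mul_right (hfg w) _) _

theorem continuous_bellman : Continuous G.bellman := by
  classical
  refine continuous_pi fun v => ?_
  have hadd (w : V) : Continuous fun f : V → ℝ≥0∞ => (G.r v : ℝ≥0∞) + f w := by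
    fun_prop
  by_cases hv : v ∈ G.terminal
  · simp only [bellman_terminal _ hv, continuous_const]
  rcases hk : G.kind v
  · simp only [bellman_player1 _ hv hk, ← Set.mem_toFinset, ← Finset.sup_eq_iSup]
    exact Continuous.finset_sup_apply fun w _ => hadd w
  · simp only [bellman_player2 _ hv hk, ← Set.mem_toFinset, ← Finset.inf_eq_iInf]
    exact Continuous.finset_inf_apply fun w _ => hadd w
  · simp only [bellman_random _ hv hk]
    exact continuous_const.add <| continuous_finsetSum _ fun w _ =>
      (ENNReal.continuous_const_mul ENNReal.coe_ne_top).comp (continuous_apply w)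

variable [MeasurableSpace V] [DiscreteMeasurableSpace V]

theorem bellman_eq_lintegral_step_of_random {f : V → ℝ≥0∞} {v : V} (hv : v ∉ G.terminal)
    (hk : G.kind v = VertexKind.random) (σ₁ : G.Strategy1) (σ₂ : G.Strategy2) (l : List V) :
    G.bellman f v = G.r v + ∫⁻ w, f w ∂(step σ₁ σ₂ l v).toMeasure := by
  rw [bellman_random f hv hk, step_random _ _ _ hk, lintegral_fintype]
  simp only [PMF.toMeasure_apply_singleton _ _ (measurableSet_singleton _), randomStep_apply,
    mul_comm]

theorem bellman_le_add_lintegral_step {f : V → ℝ≥0∞} {c : ∀ v, G.post v}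
    (hc : ∀ v, ∀ w ∈ G.post v, f w ≤ f (c v)) {σ₁ : G.Strategy1} {l : List V}
    (hσ₁ : ∀ v, σ₁.move l v = PMF.pure (c v : V)) (σ₂ : G.Strategy2) (v : V) :
    G.bellman f v ≤ G.r v + ∫⁻ w, f w ∂(step σ₁ σ₂ l v).toMeasure := by
  by_cases hv : v ∈ G.terminal
  · rw [bellman_terminal f hv]; exact zero_le
  rcases hk : G.kind v
  · rw [bellman_player1 f hv hk, step_player1 _ _ _ hk, hσ₁, lintegral_toMeasure_pure]
    exact iSup₂_le fun w hw => add_le_add_right (hc v w hw) _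
  · rw [bellman_player2 f hv hk]
    obtain ⟨d, hd⟩ := G.exists_argmin f
    refine (iInf₂_le (d v : V) (d v).2).trans (add_le_add_right ?_ _)
    calc f (d v) = ∫⁻ _, f (d v) ∂(step σ₁ σ₂ l v).toMeasure := by simp
      _ ≤ ∫⁻ w, f w ∂(step σ₁ σ₂ l v).toMeasure :=
          lintegral_mono_ae ((ae_step_mem_post σ₁ σ₂ l v).mono (hd v))
  · exact (bellman_eq_lintegral_step_of_random hv hk σ₁ σ₂ l).le

theorem add_lintegral_step_le_bellman {f : V → ℝ≥0∞} (hf : ∀ v ∈ G.terminal, f v = 0)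
    {c : ∀ v, G.post v} (hc : ∀ v, ∀ w ∈ G.post v, f (c v) ≤ f w) (σ₁ : G.Strategy1)
    {σ₂ : G.Strategy2} {l : List V} (hσ₂ : ∀ v, σ₂.move l v = PMF.pure (c v : V)) (v : V) :
    G.r v + ∫⁻ w, f w ∂(step σ₁ σ₂ l v).toMeasure ≤ G.bellman f v := by
  by_cases hv : v ∈ G.terminal
  · rw [lintegral_step_of_mem_terminal _ _ _ hv, hf v hv, G.r_terminal v hv,
      bellman_terminal f hv, ENNReal.coe_zero, add_zero]
  rcases hk : G.kind v
  · rw [bellman_player1 f hv hk]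
    obtain ⟨d, hd⟩ := G.exists_argmax f
    refine (add_le_add_right ?_ _).trans
      (le_iSup₂_of_le (f := fun w _ => (G.r v : ℝ≥0∞) + f w) (d v : V) (d v).2 le_rfl)
    calc ∫⁻ w, f w ∂(step σ₁ σ₂ l v).toMeasure ≤ ∫⁻ _, f (d v) ∂(step σ₁ σ₂ l v).toMeasure :=
          lintegral_mono_ae ((ae_step_mem_post σ₁ σ₂ l v).mono (hd v))
      _ = f (d v) := by simp
  · rw [bellman_player2 f hv hk, step_player2 _ _ _ hk, hσ₂, lintegral_toMeasure_pure]
    exact le_iInf₂ fun w hw => add_le_add_right (hc v w hw) _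
  · exact (bellman_eq_lintegral_step_of_random hv hk σ₁ σ₂ l).ge

end Bellman

section Rewards

variable {V : Type*} [Fintype V] {G : RewardGame V} [MeasurableSpace V]
  [DiscreteMeasurableSpace V]

theorem expRew_eq_tsum (σ₁ : G.Strategy1) (σ₂ : G.Strategy2) (v : V) :
    G.expRew σ₁ σ₂ v = ∑' n, ∫⁻ ω, (G.r (ω n) : ℝ≥0∞) ∂prob σ₁ σ₂ v :=
  lintegral_tsum fun n => (measurable_comp_eval (fun w => (G.r w : ℝ≥0∞)) n).aemeasurable

theorem expRew_le_of_add_lintegral_step_le {σ₁ : G.Strategy1} {σ₂ : G.Strategy2}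
    {φ : ℕ → V → ℝ≥0∞} (hφ : ∀ (l : List V) (v : V),
      G.r v + ∫⁻ w, φ (l.length + 1) w ∂(step σ₁ σ₂ l v).toMeasure ≤ φ l.length v) (v : V) :
    G.expRew σ₁ σ₂ v ≤ φ 0 v := by
  rw [expRew_eq_tsum, ← lintegral_prob_zero σ₁ σ₂ v (φ 0)]
  refine tsum_le_of_add_succ_le (a := fun n => ∫⁻ ω, φ n (ω n) ∂prob σ₁ σ₂ v) fun n => ?_
  rw [lintegral_add_lintegral_prob_succ σ₁ σ₂ v (fun w => (G.r w : ℝ≥0∞))]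
  refine lintegral_mono fun ω => ?_
  simpa only [length_history] using hφ (history ω n) (ω n)

theorem le_expRew_add_lintegral {σ₁ : G.Strategy1} {σ₂ : G.Strategy2} {f : V → ℝ≥0∞}
    (hf : ∀ (l : List V) (v : V), f v ≤ G.r v + ∫⁻ w, f w ∂(step σ₁ σ₂ l v).toMeasure) (v : V)
    (n : ℕ) : f v ≤ G.expRew σ₁ σ₂ v + ∫⁻ ω, f (ω n) ∂prob σ₁ σ₂ v := by
  have hpartial : f v ≤ ∑ k ∈ Finset.range n, ∫⁻ ω, (G.r (ω k) : ℝ≥0∞) ∂prob σ₁ σ₂ v +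
      ∫⁻ ω, f (ω n) ∂prob σ₁ σ₂ v := by
    induction n with
    | zero => simp [lintegral_prob_zero]
    | succ n ih =>
      rw [Finset.sum_range_succ, add_assoc,
        lintegral_add_lintegral_prob_succ σ₁ σ₂ v (fun w => (G.r w : ℝ≥0∞))]
      exact ih.trans (add_le_add_right (lintegral_mono fun ω => hf _ _) _)
  rw [expRew_eq_tsum]
  exact hpartial.trans (add_le_add_left (ENNReal.sum_le_tsum _) _)

end Rewards

section Values

variable {V : Type*} [Fintype V] {G : RewardGame V} [MeasurableSpace V]
  [DiscreteMeasurableSpace V]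

theorem tendsto_lintegral_prob_zero (hG : G.StoppingUnderFairness) {f : V → ℝ≥0∞}
    (hf_top : ∀ v, f v ≠ ⊤) (hf_zero : ∀ v ∈ G.terminal, f v = 0) (σ₁ : G.Strategy1)
    {σ₂ : G.Strategy2} (hσ₂ : σ₂ ∈ G.fairStrategies) (v : V) :
    Filter.Tendsto (fun n => ∫⁻ ω, f (ω n) ∂prob σ₁ σ₂ v) Filter.atTop (nhds 0) := by
  obtain ⟨C, hC_top, hfC⟩ := exists_ne_top_forall_le hf_top
  rw [← lintegral_zero (μ := prob σ₁ σ₂ v)]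
  refine tendsto_lintegral_of_dominated_convergence (fun _ => C)
    (fun n => measurable_comp_eval f n) (fun n => ae_of_all _ fun ω => hfC (ω n))
    (by simpa using hC_top) ?_
  filter_upwards [hG.ae_eventually_mem_terminal σ₁ hσ₂ v] with ω hω
  exact tendsto_const_nhds.congr' (hω.mono fun n hn => (hf_zero _ hn).symm)

theorem exists_detMemoryless1_forall_le_expRew (hG : G.StoppingUnderFairness) {f : V → ℝ≥0∞}
    (hf : f ≤ G.bellman f) (hf_top : ∀ v, f v ≠ ⊤) :
    ∃ σ₁ ∈ G.detMemoryless1, ∀ σ₂ ∈ G.fairStrategies, ∀ v, f v ≤ G.expRew σ₁ σ₂ v := by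
  obtain ⟨c, hc⟩ := G.exists_argmax f
  refine ⟨Strategy.markov fun _ => c,
    ⟨Strategy.deterministic_markov _, Strategy.memoryless_markov_const c⟩, fun σ₂ hσ₂ v => ?_⟩
  have hf_zero (w : V) (hw : w ∈ G.terminal) : f w = 0 :=
    le_zero_iff.1 ((hf w).trans_eq (bellman_terminal f hw))
  have hlim := (tendsto_lintegral_prob_zero hG hf_top hf_zero (Strategy.markov fun _ => c) hσ₂
    v).const_add (G.expRew (Strategy.markov fun _ => c) σ₂ v)
  rw [add_zero] at hlim
  exact ge_of_tendsto' hlim <| le_expRew_add_lintegral (fun l w =>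
    (hf w).trans (bellman_le_add_lintegral_step hc (fun _ => rfl) σ₂ w)) v

theorem le_lowerValue (hG : G.StoppingUnderFairness) {f : V → ℝ≥0∞} (hf : f ≤ G.bellman f)
    (hf_top : ∀ v, f v ≠ ⊤) (v : V) : f v ≤ G.lowerValue v := by
  obtain ⟨σ₁, -, hσ₁⟩ := exists_detMemoryless1_forall_le_expRew hG hf hf_top
  exact le_iSup_of_le σ₁ (le_iInf₂ fun σ₂ hσ₂ => hσ₁ σ₂ hσ₂ v)

theorem le_bound (hG : G.StoppingUnderFairness) {f : V → ℝ≥0∞} (hf : f ≤ G.bellman f)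
    (hf_top : ∀ v, f v ≠ ⊤) (v : V) : f v ≤ G.bound := by
  obtain ⟨σ₁, hmem, hσ₁⟩ := exists_detMemoryless1_forall_le_expRew hG hf hf_top
  exact le_iSup_of_le v (le_iInf₂ fun σ₂ hσ₂ => le_iSup₂_of_le σ₁ hmem (hσ₁ σ₂ hσ₂.2.2 v))

theorem lowerValue_le_upperValue (v : V) : G.lowerValue v ≤ G.upperValue v :=
  iSup_le fun σ₁ => le_iInf₂ fun σ₂ hσ₂ =>
    (iInf₂_le σ₂ hσ₂).trans (le_iSup (fun σ₁ => G.expRew σ₁ σ₂ v) σ₁)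

end Values

section ValueIteration

variable {V : Type*} [Fintype V] {G : RewardGame V} [MeasurableSpace V]

theorem bellman_iterate_eq_zero {R : ℝ≥0∞} {c : ∀ v, G.post v} {g : V → ℝ≥0∞}
    (hg : G.IsPotential R c g) (n : ℕ) {v : V} (hv : v ∈ G.terminal) : G.bellman^[n] g v = 0 := by
  cases n with
  | zero => exact hg.eq_zero v hv
  | succ n => rw [Function.iterate_succ_apply', bellman_terminal _ hv]

variable [DiscreteMeasurableSpace V]

theorem exists_isPotential_reward_le (hG : G.StoppingUnderFairness) :
    ∃ R c g, R ≠ 0 ∧ (∀ v, (G.r v : ℝ≥0∞) ≤ R) ∧ G.IsPotential R c g := by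
  obtain ⟨R, hR_top, hR⟩ :=
    exists_ne_top_forall_le (f := fun v => (G.r v : ℝ≥0∞)) fun _ => ENNReal.coe_ne_top
  obtain ⟨c, g, hg⟩ := hG.exists_isPotential (R := R + 1) (by finiteness)
  exact ⟨R + 1, c, g, by simp, fun v => (hR v).trans le_self_add, hg⟩

variable {R : ℝ≥0∞} {c : ∀ v, G.post v} {g : V → ℝ≥0∞}

theorem reward_add_lintegral_step_le (hrR : ∀ v, G.r v ≤ R) (hg : G.IsPotential R c g)
    (σ₁ : G.Strategy1) {σ₂ : G.Strategy2} {l : List V}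
    (hσ₂ : ∀ v, σ₂.move l v = PMF.pure (c v : V)) (v : V) :
    G.r v + ∫⁻ w, g w ∂(step σ₁ σ₂ l v).toMeasure ≤ g v := by
  refine (add_le_add_left ?_ _).trans (hg.indicator_add_lintegral_le σ₁ hσ₂ v)
  by_cases hv : v ∈ G.terminal
  · simp [G.r_terminal v hv]
  · rw [Set.indicator_of_mem hv]
    exact hrR v

theorem bellman_le_of_isPotential (hrR : ∀ v, G.r v ≤ R) (hg : G.IsPotential R c g) :
    G.bellman g ≤ g := by
  intro v
  obtain ⟨d, hd⟩ := G.exists_argmax g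
  exact (bellman_le_add_lintegral_step (σ₁ := Strategy.markov fun _ => d) (l := []) hd
    (fun _ => rfl) (Strategy.markov fun _ => c) v).trans
    (reward_add_lintegral_step_le hrR hg _ (fun _ => rfl) v)

theorem expRew_markov_le_bellman_iterate (hrR : ∀ v, G.r v ≤ R) (hg : G.IsPotential R c g)
    {n : ℕ} {e : ℕ → ∀ v, G.post v}
    (he_min : ∀ k < n, ∀ v, ∀ w ∈ G.post v,
      G.bellman^[n - (k + 1)] g (e k v) ≤ G.bellman^[n - (k + 1)] g w)
    (he : ∀ k, e (n + k) = c) (σ₁ : G.Strategy1) (v : V) :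
    G.expRew σ₁ (Strategy.markov e) v ≤ G.bellman^[n] g v := by
  refine expRew_le_of_add_lintegral_step_le (φ := fun k => G.bellman^[n - k] g) (fun l v => ?_) v
  rcases lt_or_ge l.length n with hl | hl
  · have hsub : n - l.length = n - (l.length + 1) + 1 := by lia
    simp only [hsub, Function.iterate_succ_apply']
    exact add_lintegral_step_le_bellman (fun w hw => bellman_iterate_eq_zero hg _ hw)
      (he_min _ hl) σ₁ (fun _ => rfl) v
  · obtain ⟨k, hk⟩ := Nat.exists_eq_add_of_le hl
    simp only [Nat.sub_eq_zero_of_le hl, Nat.sub_eq_zero_of_le (hl.trans l.length.le_succ),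
      Function.iterate_zero, id_eq]
    exact reward_add_lintegral_step_le hrR hg σ₁
      (fun w => by rw [Strategy.markov_move, hk, he]) v

theorem bound_ne_top (hG : G.StoppingUnderFairness) : G.bound ≠ ⊤ := by
  obtain ⟨R, c, g, hR, hrR, hg⟩ := exists_isPotential_reward_le hG
  obtain ⟨C, hC_top, hgC⟩ := exists_ne_top_forall_le hg.ne_top
  have hmem : Strategy.markov (fun _ => c) ∈ G.detMemorylessFair2 :=
    ⟨Strategy.deterministic_markov _, Strategy.memoryless_markov_const c,
      hg.markov_mem_fairStrategies hR (n := 0) fun _ => rfl⟩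
  have hle (σ₁ : G.Strategy1) (v : V) : G.expRew σ₁ (Strategy.markov fun _ => c) v ≤ g v :=
    expRew_markov_le_bellman_iterate hrR hg (n := 0) (by simp) (fun _ => rfl) σ₁ v
  exact ne_top_of_le_ne_top hC_top <| iSup_le fun v => iInf₂_le_of_le _ hmem <|
    iSup₂_le fun σ₁ _ => (hle σ₁ v).trans (hgC v)

-- With `n` steps to go Player 2 minimizes the `n - 1`-st iterate; when the iterates are used up she
-- heads for the terminal vertices by playing `c`, which makes the strategy fair.
theorem upperValue_le_bellman_iterate (hR : R ≠ 0) (hrR : ∀ v, G.r v ≤ R)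
    (hg : G.IsPotential R c g) (n : ℕ) (v : V) : G.upperValue v ≤ G.bellman^[n] g v := by
  choose d hd using fun m => G.exists_argmin (G.bellman^[m] g)
  set e : ℕ → ∀ v, G.post v := fun k => if k < n then d (n - (k + 1)) else c
  have he (k : ℕ) : e (n + k) = c := if_neg (by lia)
  refine iInf₂_le_of_le (Strategy.markov e) (hg.markov_mem_fairStrategies hR he) <|
    iSup_le fun σ₁ => expRew_markov_le_bellman_iterate hrR hg (fun k hk => ?_) he σ₁ v
  simpa only [e, if_pos hk] using hd (n - (k + 1))

theorem exists_bellman_eq_self_upperValue_le (hG : G.StoppingUnderFairness) :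
    ∃ f, G.bellman f = f ∧ (∀ v, f v ≠ ⊤) ∧ ∀ v, G.upperValue v ≤ f v := by
  obtain ⟨R, c, g, hR, hrR, hg⟩ := exists_isPotential_reward_le hG
  have hanti : Antitone fun n => G.bellman^[n] g :=
    bellman_mono.antitone_iterate_of_map_le (bellman_le_of_isPotential hrR hg)
  refine ⟨⨅ n, G.bellman^[n] g,
    isFixedPt_of_tendsto_iterate (tendsto_atTop_iInf hanti) continuous_bellman.continuousAt,
    fun v => ne_top_of_le_ne_top (hg.ne_top v) (iInf_le (fun n => G.bellman^[n] g) 0 v),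
    fun v => ?_⟩
  rw [iInf_apply]
  exact le_iInf fun n => upperValue_le_bellman_iterate hR hrR hg n v

end ValueIteration

end RewardGame

theorem mainTheorem1 {V : Type*} [Fintype V] [MeasurableSpace V] [DiscreteMeasurableSpace V]
    (G : RewardGame V) (hG : G.StoppingUnderFairness) :
    G.bound ≠ ⊤ ∧
      ∃ ν : V → ℝ≥0∞, IsGreatest G.bellmanFixedPoints ν ∧
        ∀ v : V, G.upperValue v = G.lowerValue v ∧ G.lowerValue v = ν v := by
  obtain ⟨f, hf, hf_top, hupper⟩ := RewardGame.exists_bellman_eq_self_upperValue_le hG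
  have hlower := RewardGame.le_lowerValue hG hf.ge hf_top
  have hle := RewardGame.lowerValue_le_upperValue (G := G)
  refine ⟨RewardGame.bound_ne_top hG, f,
    ⟨⟨RewardGame.le_bound hG hf.ge hf_top, hf⟩, fun f' hf' v => ?_⟩,
    fun v => ⟨((hupper v).trans (hlower v)).antisymm (hle v),
      ((hle v).trans (hupper v)).antisymm (hlower v)⟩⟩
  have hf'_top (w : V) : f' w ≠ ⊤ :=
    ne_top_of_le_ne_top (RewardGame.bound_ne_top hG) (hf'.1 w)
  calc f' v ≤ G.lowerValue v := RewardGame.le_lowerValue hG hf'.2.ge hf'_top v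
    _ ≤ G.upperValue v := hle v
    _ ≤ f v := hupper v
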